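/- Let $k$ be an arbitrary field, and let $H$ be a finite group acting by automorphisms on a (discrete) group $\Gamma$. The smash coproduct $k[\Gamma]\rtimes k^H$ is the Hopf algebra which is $k[\Gamma]\otimes k^H$ as an algebra (write $r\#f$ for $r\otimes f$, and $\delta_h\in k^H$ for the indicator function of $h$), with $$\Delta(r\#\delta_h)=\sum_{l\in H}(r\#\delta_{l^{-1}})\otimes (l.r\#\delta_{lh}),\qquad \varepsilon(r\#\delta_h)=\delta_{h,1},\qquad S(r\#\delta_h)=h^{-1}.r^{-1}\#\delta_{h^{-1}}\qquad (r\in\Gamma,\ h\in H).$$ A quotient datum for the action of $H$ on $\Gamma$ is a triple $(G,N,\Phi)$ where $G\subset H$ is a subgroup, $N\triangleleft\Gamma$ is a normal and $G$-stable subgroup, and $\Phi:N\to (k^G)^\times$ is a group morphism such that $$\Phi(r)(lh)=\Phi(l^{-1}.r)(h)\,\Phi(r)(l),\qquad \Phi(r)=\Phi(srs^{-1})\qquad (r\in N,\ s\in\Gamma,\ h,l\in G).$$ Given such a datum, let $G$ act on $\Gamma/N$ by the induced action and choose a section $j:\Gamma/N\to\Gamma$ of the canonical projection with $j(1)=1$.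 Then $k[\Gamma/N]\rtimes_\Phi k^G$ denotes the vector space $k[\Gamma/N]\otimes k^G$ with unit $1\#1$, counit $\varepsilon(x\#\delta_h)=\delta_{h,1}$, and $$(x\#\delta_h)(y\#\delta_g)=xy\#\delta_h\delta_g\,\Phi\big(j(x)j(y)j(xy)^{-1}\big),$$ $$\Delta(x\#\delta_h)=\sum_{l\in G}(x\#\delta_{l^{-1}})\otimes\big(l.x\#\delta_{lh}\,\Phi(l.j(x)\,j(l.x)^{-1})\big),$$ $$S(x\#\delta_h)=h^{-1}.x^{-1}\#\Phi\big(j(h^{-1}.x^{-1})^{-1}\;h^{-1}.j(x)^{-1}\big)\,\delta_{h^{-1}}$$ for $x,y\in\Gamma/N$ and $h,g\in G$; this is a Hopf algebra, which up to isomorphism does not depend on $j$. Theorem. Let $L$ be a Hopf algebra quotient of $k[\Gamma]\rtimes k^H$, that is, a Hopf algebra over $k$ with a surjective Hopf algebra map $k[\Gamma]\rtimes k^H\to L$. Then there exists a quotient datum $(G,N,\Phi)$ for the action of $H$ on $\Gamma$ such that, for every choice of the section $j$, $L$ is isomorphic as a Hopf algebra to $k[\Gamma/N]\rtimes_\Phi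 k^G$. -/

import Mathlib

open scoped TensorProduct

noncomputable section

/-! ### Verifying the Hopf algebra axioms on a basis

Throughout this part `b` is a basis of `A` indexed by `Q × G`, and the structure maps send basis
vectors to combinations of basis vectors with scalar coefficients `σ`, `τ`, `s`. These are only
auxiliary facts for the two constructions below. -/

namespace MonomialHopf

/-- The scalar identities that make a monomial structure on a basis indexed by `Q × G` a Hopf
algebra. -/
structure Compat {k Q G : Type*} [Field k] [Group Q] [Group G] (act : G → Q →* Q)
    (σ : Q → Q → G → k) (τ : G → Q → G → k) (s : Q → G → k) : Prop where
  one_smul : ∀ x, act 1 x = x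
  mul_smul : ∀ p m x, act (p * m) x = act p (act m x)
  assoc : ∀ x y z h, σ x y h * σ (x * y) z h = σ y z h * σ x (y * z) h
  one_left : ∀ x h, σ 1 x h = 1
  one_right : ∀ x h, σ x 1 h = 1
  coassoc : ∀ p m x h, τ (p * m) x (p * m * h) * τ m x p⁻¹ =
    τ m x (m * h) * τ p (act m x) (p * m * h)
  one_act : ∀ x h, τ 1 x h = 1
  eval_one : ∀ l x, τ l x 1 = 1
  act_one : ∀ l h, τ l 1 h = 1
  mul_eval_one : ∀ x y, σ x y 1 = 1
  compat : ∀ l x y h, σ x y h * τ l (x * y) (l * h) =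
    τ l x (l * h) * τ l y (l * h) * (σ x y l⁻¹ * σ (act l x) (act l y) (l * h))
  antipode_left : ∀ l x, τ l x l * s x l⁻¹ * σ (act l x⁻¹) (act l x) l = 1
  antipode_right : ∀ l x, τ l x l * s (act l x) l * σ x x⁻¹ l⁻¹ = 1

theorem basis_induction {k ι A : Type*} [Field k] [AddCommGroup A] [Module k A]
    (b : Module.Basis ι k A) {p : A → Prop} (hb : ∀ i, p (b i)) (h0 : p 0)
    (ha : ∀ x y, p x → p y → p (x + y)) (hs : ∀ (c : k) x, p x → p (c • x)) (a : A) : p a := by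
  refine Submodule.span_induction (p := fun x _ => p x) ?_ h0 (fun x y _ _ => ha x y)
    (fun c x _ => hs c x) (b.mem_span a)
  rintro _ ⟨i, rfl⟩
  exact hb i

set_option linter.unusedSectionVars false

section Ring

variable {k Q G A : Type*} [Field k] [Group Q] [Group G] [Fintype G] [DecidableEq G]
  [AddCommGroup A] [Module k A] (b : Module.Basis (Q × G) k A)
  {act : G → Q →* Q} {σ : Q → Q → G → k} {τ : G → Q → G → k} {s : Q → G → k}

theorem mul_assoc_of_compat (H : Compat act σ τ s) (μ : A →ₗ[k] A →ₗ[k] A)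
    (hμ : ∀ x h y g, μ (b (x, h)) (b (y, g)) = if h = g then σ x y h • b (x * y, h) else 0)
    (u v w : A) : μ (μ u v) w = μ u (μ v w) := by
  induction u using basis_induction b with
  | h0 => simp
  | ha x y hx hy => simp [hx, hy]
  | hs c x hx => simp [hx]
  | hb i =>
  induction v using basis_induction b with
  | h0 => simp
  | ha x y hx hy => simp [hx, hy]
  | hs c x hx => simp [hx]
  | hb j =>
  induction w using basis_induction b with
  | h0 => simp
  | ha x y hx hy => simp [hx, hy]
  | hs c x hx => simp [hx]
  | hb l =>
  obtain ⟨x, h⟩ := i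
  obtain ⟨y, g⟩ := j
  obtain ⟨z, f⟩ := l
  by_cases h1 : h = g <;> by_cases h2 : g = f
  · subst h1; subst h2
    simp [hμ, smul_smul, H.assoc, _root_.mul_assoc]
  · subst h1
    simp [hμ, h2]
  · subst h2
    simp [hμ, h1]
  · simp [hμ, h1, h2]

theorem one_mul_of_compat (H : Compat act σ τ s) (μ : A →ₗ[k] A →ₗ[k] A)
    (hμ : ∀ x h y g, μ (b (x, h)) (b (y, g)) = if h = g then σ x y h • b (x * y, h) else 0)
    (e : A) (he : e = ∑ h, b (1, h)) (u : A) : μ e u = u := by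
  induction u using basis_induction b with
  | h0 => simp
  | ha x y hx hy => simp [hx, hy]
  | hs c x hx => simp [hx]
  | hb i =>
  obtain ⟨x, h⟩ := i
  simp [he, hμ, H.one_left]

theorem mul_one_of_compat (H : Compat act σ τ s) (μ : A →ₗ[k] A →ₗ[k] A)
    (hμ : ∀ x h y g, μ (b (x, h)) (b (y, g)) = if h = g then σ x y h • b (x * y, h) else 0)
    (e : A) (he : e = ∑ h, b (1, h)) (u : A) : μ u e = u := by
  induction u using basis_induction b with
  | h0 => simp
  | ha x y hx hy => simp [hx, hy]
  | hs c x hx => simp [hx]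
  | hb i =>
  obtain ⟨x, h⟩ := i
  simp [he, hμ, H.one_right]

end Ring

section Hopf

variable {k Q G A : Type*} [Field k] [Group Q] [Group G] [Fintype G] [DecidableEq G]
  [Ring A] [Algebra k A] (b : Module.Basis (Q × G) k A)
  {act : G → Q →* Q} {σ : Q → Q → G → k} {τ : G → Q → G → k} {s : Q → G → k}

theorem coassoc_of_compat (H : Compat act σ τ s) (Δ : A →ₗ[k] A ⊗[k] A)
    (hΔ : ∀ x h, Δ (b (x, h)) =
      ∑ l, b (x, l⁻¹) ⊗ₜ[k] (τ l x (l * h) • b (act l x, l * h))) :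
    (TensorProduct.assoc k A A A).toLinearMap ∘ₗ Δ.rTensor A ∘ₗ Δ = Δ.lTensor A ∘ₗ Δ := by
  refine b.ext fun ⟨x, h⟩ => ?_
  simp only [LinearMap.comp_apply, hΔ, map_sum, LinearMap.rTensor_tmul, LinearMap.lTensor_tmul,
    map_smul, TensorProduct.sum_tmul, TensorProduct.tmul_sum, LinearEquiv.coe_coe,
    TensorProduct.assoc_tmul, TensorProduct.tmul_smul, ← TensorProduct.smul_tmul',
    Finset.smul_sum, smul_smul]
  rw [Finset.sum_comm]
  refine Finset.sum_congr rfl fun m _ => ?_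
  rw [← Equiv.sum_comp (Equiv.mulRight m)]
  refine Finset.sum_congr rfl fun p _ => ?_
  have := H.coassoc p m x h
  simp only [Equiv.coe_mulRight, mul_inv_rev, mul_inv_cancel_left, H.mul_smul, mul_assoc] at *
  rw [this]

theorem rTensor_of_compat (H : Compat act σ τ s) (Δ : A →ₗ[k] A ⊗[k] A) (ε : A →ₗ[k] k)
    (hΔ : ∀ x h, Δ (b (x, h)) =
      ∑ l, b (x, l⁻¹) ⊗ₜ[k] (τ l x (l * h) • b (act l x, l * h)))
    (hε : ∀ x h, ε (b (x, h)) = if h = 1 then 1 else 0) :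
    ε.rTensor A ∘ₗ Δ = TensorProduct.mk k _ _ 1 := by
  refine b.ext fun ⟨x, h⟩ => ?_
  simp only [LinearMap.comp_apply, hΔ, map_sum, LinearMap.rTensor_tmul, hε]
  rw [Finset.sum_eq_single 1]
  · simp [H.one_act, H.one_smul]
  · intro l _ hl
    simp [hl]
  · simp

theorem lTensor_of_compat (H : Compat act σ τ s) (Δ : A →ₗ[k] A ⊗[k] A) (ε : A →ₗ[k] k)
    (hΔ : ∀ x h, Δ (b (x, h)) =
      ∑ l, b (x, l⁻¹) ⊗ₜ[k] (τ l x (l * h) • b (act l x, l * h)))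
    (hε : ∀ x h, ε (b (x, h)) = if h = 1 then 1 else 0) :
    ε.lTensor A ∘ₗ Δ = (TensorProduct.mk k _ _).flip 1 := by
  refine b.ext fun ⟨x, h⟩ => ?_
  simp only [LinearMap.comp_apply, hΔ, map_sum, LinearMap.lTensor_tmul, map_smul, hε]
  rw [Finset.sum_eq_single h⁻¹]
  · simp [H.eval_one]
  · intro l _ hl
    have : l * h ≠ 1 := fun h' => hl (eq_inv_of_mul_eq_one_left h')
    simp [this]
  · simp

theorem counit_mul_of_compat (H : Compat act σ τ s) (ε : A →ₗ[k] k)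
    (hmul : ∀ x h y g, b (x, h) * b (y, g) = if h = g then σ x y h • b (x * y, h) else 0)
    (hε : ∀ x h, ε (b (x, h)) = if h = 1 then 1 else 0) (u v : A) :
    ε (u * v) = ε u * ε v := by
  induction u using basis_induction b with
  | h0 => simp
  | ha x y hx hy => simp [hx, hy, add_mul]
  | hs c x hx => simp [hx, mul_assoc]
  | hb i =>
  induction v using basis_induction b with
  | h0 => simp
  | ha x y hx hy => simp [hx, hy, mul_add]
  | hs c x hx => simp [hx, mul_left_comm]
  | hb j =>
  obtain ⟨x, h⟩ := i
  obtain ⟨y, g⟩ := j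
  by_cases h1 : h = g
  · subst h1
    by_cases h2 : h = 1
    · subst h2
      simp [hmul, hε, H.mul_eval_one]
    · simp [hmul, hε, h2]
  · by_cases h2 : h = 1
    · subst h2
      simp [hmul, hε, h1, Ne.symm h1]
    · simp [hmul, hε, h1, h2]

theorem comul_one_of_compat (H : Compat act σ τ s) (Δ : A →ₗ[k] A ⊗[k] A)
    (hone : (1 : A) = ∑ h, b (1, h))
    (hΔ : ∀ x h, Δ (b (x, h)) =
      ∑ l, b (x, l⁻¹) ⊗ₜ[k] (τ l x (l * h) • b (act l x, l * h))) :
    Δ 1 = 1 := by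
  rw [Algebra.TensorProduct.one_def, hone, map_sum, TensorProduct.sum_tmul]
  simp only [hΔ, H.act_one, one_smul, map_one]
  rw [Finset.sum_comm, ← Equiv.sum_comp (Equiv.inv G)]
  refine Finset.sum_congr rfl fun l _ => ?_
  rw [TensorProduct.tmul_sum, ← Equiv.sum_comp (Equiv.mulLeft l)]
  simp

theorem comul_mul_of_compat (H : Compat act σ τ s) (Δ : A →ₗ[k] A ⊗[k] A)
    (hmul : ∀ x h y g, b (x, h) * b (y, g) = if h = g then σ x y h • b (x * y, h) else 0)
    (hΔ : ∀ x h, Δ (b (x, h)) =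
      ∑ l, b (x, l⁻¹) ⊗ₜ[k] (τ l x (l * h) • b (act l x, l * h))) (u v : A) :
    Δ (u * v) = Δ u * Δ v := by
  induction u using basis_induction b with
  | h0 => simp
  | ha x y hx hy => simp [hx, hy, add_mul]
  | hs c x hx => simp [hx]
  | hb i =>
  induction v using basis_induction b with
  | h0 => simp
  | ha x y hx hy => simp [hx, hy, mul_add]
  | hs c x hx => simp [hx]
  | hb j =>
  obtain ⟨x, h⟩ := i
  obtain ⟨y, g⟩ := j
  have expand : Δ (b (x, h)) * Δ (b (y, g)) =
      ∑ l, (b (x, l⁻¹) * b (y, l⁻¹)) ⊗ₜ[k] ((τ l x (l * h) • b (act l x, l * h)) *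
        (τ l y (l * g) • b (act l y, l * g))) := by
    rw [hΔ, hΔ, Finset.sum_mul_sum]
    refine Finset.sum_congr rfl fun l _ => ?_
    rw [Finset.sum_eq_single l]
    · simp only [Algebra.TensorProduct.tmul_mul_tmul]
    · intro m _ hm
      simp [Algebra.TensorProduct.tmul_mul_tmul, hmul, Ne.symm hm]
    · simp
  rw [expand]
  by_cases h1 : h = g
  · subst h1
    simp only [hmul, if_true, map_smul, hΔ, Finset.smul_sum]
    refine Finset.sum_congr rfl fun l _ => ?_
    simp only [smul_mul_smul_comm, hmul, if_true, smul_smul, TensorProduct.tmul_smul,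
      ← TensorProduct.smul_tmul', map_mul, H.compat]
    congr 1
    ring
  · simp [hmul, h1]

theorem antipode_left_of_compat (H : Compat act σ τ s) (Δ : A →ₗ[k] A ⊗[k] A) (ε : A →ₗ[k] k)
    (S : A →ₗ[k] A) (hone : (1 : A) = ∑ h, b (1, h))
    (hmul : ∀ x h y g, b (x, h) * b (y, g) = if h = g then σ x y h • b (x * y, h) else 0)
    (hΔ : ∀ x h, Δ (b (x, h)) =
      ∑ l, b (x, l⁻¹) ⊗ₜ[k] (τ l x (l * h) • b (act l x, l * h)))
    (hε : ∀ x h, ε (b (x, h)) = if h = 1 then 1 else 0)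
    (hS : ∀ x h, S (b (x, h)) = s x h • b (act h⁻¹ x⁻¹, h⁻¹)) :
    LinearMap.mul' k A ∘ₗ S.rTensor A ∘ₗ Δ = Algebra.linearMap k A ∘ₗ ε := by
  refine b.ext fun ⟨x, h⟩ => ?_
  by_cases h1 : h = 1
  · subst h1
    simp only [LinearMap.comp_apply, hΔ, hε, map_sum, LinearMap.rTensor_tmul, hS,
      LinearMap.mul'_apply, smul_mul_smul_comm, hmul, if_true, mul_one, inv_inv, smul_smul,
      Algebra.linearMap_apply, map_one, hone]
    refine Finset.sum_congr rfl fun l _ => ?_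
    rw [← map_mul, inv_mul_cancel, map_one, mul_comm (s x l⁻¹), H.antipode_left, one_smul]
  · simp [hΔ, hε, hS, hmul, h1]

theorem antipode_right_of_compat (H : Compat act σ τ s) (Δ : A →ₗ[k] A ⊗[k] A) (ε : A →ₗ[k] k)
    (S : A →ₗ[k] A) (hone : (1 : A) = ∑ h, b (1, h))
    (hmul : ∀ x h y g, b (x, h) * b (y, g) = if h = g then σ x y h • b (x * y, h) else 0)
    (hΔ : ∀ x h, Δ (b (x, h)) =
      ∑ l, b (x, l⁻¹) ⊗ₜ[k] (τ l x (l * h) • b (act l x, l * h)))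
    (hε : ∀ x h, ε (b (x, h)) = if h = 1 then 1 else 0)
    (hS : ∀ x h, S (b (x, h)) = s x h • b (act h⁻¹ x⁻¹, h⁻¹)) :
    LinearMap.mul' k A ∘ₗ S.lTensor A ∘ₗ Δ = Algebra.linearMap k A ∘ₗ ε := by
  refine b.ext fun ⟨x, h⟩ => ?_
  by_cases h1 : h = 1
  · subst h1
    simp only [LinearMap.comp_apply, hΔ, hε, map_sum, LinearMap.lTensor_tmul, hS, map_smul,
      LinearMap.mul'_apply, mul_smul_comm, hmul, if_true, mul_one, smul_smul,
      Algebra.linearMap_apply, map_one, hone]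
    rw [← Equiv.sum_comp (Equiv.inv G) (fun h => b (1, h))]
    refine Finset.sum_congr rfl fun l _ => ?_
    rw [map_inv, ← H.mul_smul, inv_mul_cancel, H.one_smul, mul_inv_cancel,
      H.antipode_right, one_smul, Equiv.inv_apply]
  · simp [hΔ, hε, hS, hmul, h1]

end Hopf

end MonomialHopf

/-! ### The smash coproduct -/

section SmashCoproduct

attribute [local instance] Fintype.ofFinite Classical.decEq

/-- The underlying algebra of the smash coproduct `k[Γ] ⋊ k^H` is the tensor product algebra
`k[Γ] ⊗ k^H`. A type synonym is used since its coalgebra structure is not that of the tensor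
product. -/
def SmashCoproduct (k Γ H : Type*) [Field k] [Group Γ] [Group H] : Type _ :=
  MonoidAlgebra k Γ ⊗[k] (H → k)

namespace SmashCoproduct

variable (k Γ H : Type*) [Field k] [Group Γ] [Group H]

instance : Ring (SmashCoproduct k Γ H) :=
  inferInstanceAs (Ring (MonoidAlgebra k Γ ⊗[k] (H → k)))

instance : Algebra k (SmashCoproduct k Γ H) :=
  inferInstanceAs (Algebra k (MonoidAlgebra k Γ ⊗[k] (H → k)))

variable {k Γ H}

/-- The element `r # f = r ⊗ f`, for `r ∈ Γ` and `f ∈ k^H`. -/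
def elt (r : Γ) (f : H → k) : SmashCoproduct k Γ H :=
  (MonoidAlgebra.single r (1 : k) ⊗ₜ[k] f : MonoidAlgebra k Γ ⊗[k] (H → k))

/-- The function `δ_h`. -/
def delta (h : H) : H → k := Pi.single h 1

variable (k Γ H) in
/-- The basis `(r # δ_h)` of `k[Γ] ⋊ k^H`. -/
def basis [Finite H] : Module.Basis (Γ × H) k (SmashCoproduct k Γ H) :=
  (MonoidAlgebra.basis Γ k).tensorProduct (Pi.basisFun k H)

theorem basis_apply [Finite H] (r : Γ) (h : H) :
    basis k Γ H (r, h) = elt r (delta h) := by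
  refine (Module.Basis.tensorProduct_apply _ _ _ _).trans ?_
  rw [MonoidAlgebra.basis_apply, Pi.basisFun_apply]
  unfold elt delta
  congr!

set_option linter.unusedSectionVars false

variable [Finite H] [MulDistribMulAction H Γ]

variable (k Γ H) in
/-- `Δ(r # δ_h) = ∑_l (r # δ_{l⁻¹}) ⊗ (l.r # δ_{lh})`. -/
def comul : SmashCoproduct k Γ H →ₗ[k] SmashCoproduct k Γ H ⊗[k] SmashCoproduct k Γ H :=
  (basis k Γ H).constr k fun p =>
    ∑ l : H, elt p.1 (delta l⁻¹) ⊗ₜ[k] elt (l • p.1) (delta (l * p.2))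

variable (k Γ H) in
/-- `ε(r # δ_h) = δ_{h,1}`. -/
def counit : SmashCoproduct k Γ H →ₗ[k] k :=
  (basis k Γ H).constr k fun p => if p.2 = 1 then 1 else 0

variable (k Γ H) in
/-- `S(r # δ_h) = h⁻¹.r⁻¹ # δ_{h⁻¹}`. -/
def antipode : SmashCoproduct k Γ H →ₗ[k] SmashCoproduct k Γ H :=
  (basis k Γ H).constr k fun p => elt (p.2⁻¹ • p.1⁻¹) (delta p.2⁻¹)

theorem compat : MonomialHopf.Compat (k := k) (fun h : H => MulDistribMulAction.toMonoidHom Γ h)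
    (fun _ _ _ => 1) (fun _ _ _ => 1) (fun _ _ => 1) := by
  constructor <;> simp [mul_smul]

theorem basis_mul (x : Γ) (h : H) (y : Γ) (g : H) :
    basis k Γ H (x, h) * basis k Γ H (y, g) =
      if h = g then (1 : k) • basis k Γ H (x * y, h) else 0 := by
  simp only [basis_apply, one_smul]
  refine (Algebra.TensorProduct.tmul_mul_tmul _ _ _ _).trans ?_
  rw [MonoidAlgebra.single_mul_single, one_mul]
  by_cases hg : h = g
  · subst hg
    rw [if_pos rfl]
    unfold elt delta
    rw [← Pi.single_mul, one_mul]
  · rw [if_neg hg]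
    have e : (delta h * delta g : H → k) = 0 := by
      unfold delta
      ext f
      by_cases hf : f = h
      · subst hf; simp [hg]
      · simp [hf]
    rw [e]
    exact TensorProduct.tmul_zero _ _

theorem one_eq_sum : (1 : SmashCoproduct k Γ H) = ∑ h, basis k Γ H (1, h) := by
  simp only [basis_apply]
  unfold elt delta
  refine Eq.trans ?_ (TensorProduct.tmul_sum _ _ _)
  rw [Finset.univ_sum_single]
  rfl

theorem comul_basis (x : Γ) (h : H) : comul k Γ H (basis k Γ H (x, h)) =
    ∑ l : H, basis k Γ H (x, l⁻¹) ⊗ₜ[k] ((1 : k) •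
      basis k Γ H (MulDistribMulAction.toMonoidHom Γ l x, l * h)) := by
  rw [comul, Module.Basis.constr_basis]
  simp [basis_apply]

theorem counit_basis (x : Γ) (h : H) :
    counit k Γ H (basis k Γ H (x, h)) = if h = 1 then 1 else 0 := by
  simp [counit, Module.Basis.constr_basis]

theorem antipode_basis (x : Γ) (h : H) : antipode k Γ H (basis k Γ H (x, h)) =
    (1 : k) • basis k Γ H (MulDistribMulAction.toMonoidHom Γ h⁻¹ x⁻¹, h⁻¹) := by
  rw [antipode, Module.Basis.constr_basis]
  simp [basis_apply]

instance : Coalgebra k (SmashCoproduct k Γ H) where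
  comul := comul k Γ H
  counit := counit k Γ H
  coassoc := MonomialHopf.coassoc_of_compat _ compat _ comul_basis
  rTensor_counit_comp_comul := by
    exact MonomialHopf.rTensor_of_compat _ compat _ _ comul_basis counit_basis
  lTensor_counit_comp_comul := by
    exact MonomialHopf.lTensor_of_compat _ compat _ _ comul_basis counit_basis

instance : Bialgebra k (SmashCoproduct k Γ H) :=
  Bialgebra.mk' k _
    (by
      change counit k Γ H 1 = 1
      simp [one_eq_sum, counit_basis])
    (by
      exact MonomialHopf.counit_mul_of_compat _ compat _ basis_mul counit_basis _ _)
    (by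
      exact MonomialHopf.comul_one_of_compat _ compat _ one_eq_sum comul_basis)
    (by
      exact MonomialHopf.comul_mul_of_compat _ compat _ basis_mul comul_basis _ _)

instance : HopfAlgebra k (SmashCoproduct k Γ H) where
  antipode := antipode k Γ H
  mul_antipode_rTensor_comul := by
    exact MonomialHopf.antipode_left_of_compat _ compat _ _ _ one_eq_sum basis_mul
      comul_basis counit_basis antipode_basis
  mul_antipode_lTensor_comul := by
    exact MonomialHopf.antipode_right_of_compat _ compat _ _ _ one_eq_sum basis_mul
      comul_basis counit_basis antipode_basis

end SmashCoproduct

end SmashCoproduct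

/-! ### Quotient data and the associated Hopf algebras -/

/-- A quotient datum `(G, N, Φ)` for the action of `H` on `Γ` by automorphisms. -/
structure QuotientDatum (k Γ H : Type*) [Field k] [Group Γ] [Group H]
    [MulDistribMulAction H Γ] where
  /-- A subgroup of `H`. -/
  G : Subgroup H
  /-- A normal and `G`-stable subgroup of `Γ`. -/
  N : Subgroup Γ
  normal : N.Normal
  stable : ∀ (g : G) {r : Γ}, r ∈ N → g • r ∈ N
  /-- The group morphism `Φ : N → (k^G)ˣ`. -/
  Φ : N →* (G → k)ˣ
  Φ_mul : ∀ (r : N) (l h : G),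
    (Φ r : G → k) (l * h) = (Φ ⟨l⁻¹ • (r : Γ), stable l⁻¹ r.2⟩ : G → k) h * (Φ r : G → k) l
  Φ_conj : ∀ (r : N) (s : Γ), Φ r = Φ ⟨s * r * s⁻¹, normal.conj_mem r r.2 s⟩

namespace QuotientDatum

section

variable {k Γ H : Type*} [Field k] [Group Γ] [Group H] [MulDistribMulAction H Γ]

instance instNormal (D : QuotientDatum k Γ H) : D.N.Normal := D.normal

/-- The action of `G` on `Γ/N` induced by the action of `H` on `Γ`: `l.u(r) = u(l.r)`. -/
def act (D : QuotientDatum k Γ H) (l : D.G) : Γ ⧸ D.N →* Γ ⧸ D.N :=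
  QuotientGroup.map D.N D.N (MulDistribMulAction.toMonoidHom Γ l) fun _ hr => D.stable l hr

/-- A section `j` of the canonical projection `u : Γ → Γ/N` with `j(1) = 1`. -/
structure NormalizedSection (D : QuotientDatum k Γ H) where
  toFun : Γ ⧸ D.N → Γ
  mk_toFun : ∀ x, (toFun x : Γ ⧸ D.N) = x
  map_one : toFun 1 = 1

instance (D : QuotientDatum k Γ H) : CoeFun D.NormalizedSection fun _ => Γ ⧸ D.N → Γ :=
  ⟨NormalizedSection.toFun⟩

/-- Normalized sections exist. -/
instance (D : QuotientDatum k Γ H) : Nonempty D.NormalizedSection := by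
  classical
  refine ⟨⟨fun x => if x = 1 then 1 else x.out, fun x => ?_, if_pos rfl⟩⟩
  by_cases hx : x = 1
  · simp [hx]
  · simp [hx]

variable {D : QuotientDatum k Γ H}

theorem act_mk (l : D.G) (r : Γ) : D.act l (r : Γ ⧸ D.N) = ((l • r : Γ) : Γ ⧸ D.N) := rfl

theorem mk_smul (j : D.NormalizedSection) (l : D.G) (x : Γ ⧸ D.N) :
    ((l • j x : Γ) : Γ ⧸ D.N) = D.act l x := by
  rw [← act_mk, j.mk_toFun]

theorem mem_mul (j : D.NormalizedSection) (x y : Γ ⧸ D.N) :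
    j x * j y * (j (x * y))⁻¹ ∈ D.N := by
  rw [← QuotientGroup.eq_one_iff]
  simp [j.mk_toFun]

theorem mem_comul (j : D.NormalizedSection) (l : D.G) (x : Γ ⧸ D.N) :
    l • j x * (j (D.act l x))⁻¹ ∈ D.N := by
  rw [← QuotientGroup.eq_one_iff]
  simp [j.mk_toFun, mk_smul]

theorem mem_antipode (j : D.NormalizedSection) (x : Γ ⧸ D.N) (h : D.G) :
    (j (D.act h⁻¹ x⁻¹))⁻¹ * h⁻¹ • (j x)⁻¹ ∈ D.N := by
  rw [← QuotientGroup.eq_one_iff]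
  simp [j.mk_toFun, mk_smul, smul_inv']

/-- `Φ(j(x) j(y) j(xy)⁻¹)`, as a function on `G`. -/
def mulCoeff (j : D.NormalizedSection) (x y : Γ ⧸ D.N) : D.G → k :=
  (D.Φ ⟨_, mem_mul j x y⟩ : (D.G → k)ˣ)

/-- `Φ(l.j(x) j(l.x)⁻¹)`, as a function on `G`. -/
def comulCoeff (j : D.NormalizedSection) (l : D.G) (x : Γ ⧸ D.N) : D.G → k :=
  (D.Φ ⟨_, mem_comul j l x⟩ : (D.G → k)ˣ)

/-- `Φ(j(h⁻¹.x⁻¹)⁻¹ h⁻¹.j(x)⁻¹)`, as a function on `G`. -/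
def antipodeCoeff (j : D.NormalizedSection) (x : Γ ⧸ D.N) (h : D.G) : D.G → k :=
  (D.Φ ⟨_, mem_antipode j x h⟩ : (D.G → k)ˣ)

theorem Φ_eval_one (r : D.N) : (D.Φ r : D.G → k) 1 = 1 := by
  have h := D.Φ_mul r 1 1
  have hu : IsUnit ((D.Φ r : D.G → k) 1) := (D.Φ r).isUnit.map (Pi.evalMonoidHom _ (1 : D.G))
  have e : (⟨(1 : D.G)⁻¹ • (r : Γ), D.stable (1 : D.G)⁻¹ r.2⟩ : D.N) = r := by
    ext; simp
  rw [e, mul_one] at h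
  exact (mul_eq_left₀ hu.ne_zero).mp h.symm

theorem Φ_smul (r : Γ) (hr : r ∈ D.N) (l g : D.G) :
    (D.Φ ⟨r, hr⟩ : D.G → k) g =
      (D.Φ ⟨l • r, D.stable l hr⟩ : D.G → k) (l * g) * (D.Φ ⟨r, hr⟩ : D.G → k) l⁻¹ := by
  have h := D.Φ_mul ⟨r, hr⟩ l⁻¹ (l * g)
  simpa using h

theorem Φ_congr {r s : Γ} (hr : r ∈ D.N) (h : r = s) (g : D.G) :
    (D.Φ ⟨r, hr⟩ : D.G → k) g = (D.Φ ⟨s, h ▸ hr⟩ : D.G → k) g := by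
  subst h; rfl

theorem Φ_mul_apply {r s : Γ} (hr : r ∈ D.N) (hs : s ∈ D.N) (g : D.G) :
    (D.Φ ⟨r, hr⟩ : D.G → k) g * (D.Φ ⟨s, hs⟩ : D.G → k) g =
      (D.Φ ⟨r * s, mul_mem hr hs⟩ : D.G → k) g := by
  rw [show (⟨r * s, mul_mem hr hs⟩ : D.N) = ⟨r, hr⟩ * ⟨s, hs⟩ from rfl, map_mul]
  rfl

theorem Φ_conj_apply {r : Γ} (hr : r ∈ D.N) (s : Γ) (g : D.G) :
    (D.Φ ⟨r, hr⟩ : D.G → k) g =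
      (D.Φ ⟨s * r * s⁻¹, D.normal.conj_mem r hr s⟩ : D.G → k) g := by
  rw [D.Φ_conj ⟨r, hr⟩ s]

theorem Φ_one_apply {r : Γ} (hr : r ∈ D.N) (h : r = 1) (g : D.G) :
    (D.Φ ⟨r, hr⟩ : D.G → k) g = 1 := by
  subst h
  rw [show (⟨1, hr⟩ : D.N) = 1 from rfl, map_one]
  rfl

theorem compat (j : D.NormalizedSection) : MonomialHopf.Compat D.act (mulCoeff j) (comulCoeff j)
    (fun x h => antipodeCoeff j x h h⁻¹) where
  one_smul x := by
    induction x using QuotientGroup.induction_on with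
    | H r => simp [act_mk]
  mul_smul p m x := by
    induction x using QuotientGroup.induction_on with
    | H r => simp [act_mk, mul_smul]
  assoc x y z h := by
    unfold mulCoeff
    rw [Φ_conj_apply (mem_mul j y z) (j x), Φ_mul_apply, Φ_mul_apply]
    exact Φ_congr _ (by simp [mul_assoc]) _
  one_left x h := Φ_one_apply _ (by simp [j.map_one]) _
  one_right x h := Φ_one_apply _ (by simp [j.map_one]) _
  coassoc p m x h := by
    unfold comulCoeff
    rw [Φ_smul _ (mem_comul j m x) p (m * h), ← mul_assoc, mul_right_comm, Φ_mul_apply]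
    congr 1
    have e : D.act (p * m) x = D.act p (D.act m x) := by
      induction x using QuotientGroup.induction_on with
      | H r => simp [act_mk, mul_smul]
    exact Φ_congr _ (by simp [mul_smul, smul_mul', smul_inv', e, mul_assoc]) _
  one_act x h := by
    have e : D.act 1 x = x := by
      induction x using QuotientGroup.induction_on with
      | H r => simp [act_mk]
    exact Φ_one_apply _ (by simp [e]) _
  eval_one l x := Φ_eval_one _
  act_one l h := Φ_one_apply _ (by simp [j.map_one]) _
  mul_eval_one x y := Φ_eval_one _
  compat l x y h := by
    unfold mulCoeff comulCoeff
    rw [Φ_smul _ (mem_mul j x y) l h, Φ_conj_apply (mem_comul j l y) (j (D.act l x)),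
      mul_right_comm, Φ_mul_apply, Φ_mul_apply, mul_left_comm, Φ_mul_apply, mul_comm]
    congr 1
    exact Φ_congr _ (by simp [smul_mul', smul_inv', mul_assoc]) _
  antipode_left l x := by
    unfold mulCoeff comulCoeff antipodeCoeff
    simp only [inv_inv]
    rw [Φ_conj_apply (mem_mul j (D.act l x⁻¹) (D.act l x)) (j (D.act l x⁻¹))⁻¹, mul_right_comm,
      Φ_mul_apply, Φ_mul_apply]
    refine Φ_one_apply _ ?_ _
    rw [← map_mul, inv_mul_cancel, map_one, j.map_one]
    simp [smul_inv', mul_assoc]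
  antipode_right l x := by
    unfold mulCoeff comulCoeff antipodeCoeff
    have h1 : (D.Φ ⟨_, mem_comul j l x⟩ : D.G → k) l * (D.Φ ⟨_, D.stable l⁻¹ (mem_comul j l x)⟩ :
        D.G → k) l⁻¹ = 1 := by
      have := D.Φ_mul ⟨_, mem_comul j l x⟩ l l⁻¹
      rw [mul_inv_cancel, Φ_eval_one] at this
      rw [mul_comm]
      exact this.symm
    rw [mul_assoc, mul_comm ((D.Φ ⟨_, mem_antipode j _ _⟩ : D.G → k) l⁻¹), Φ_mul_apply]
    refine Eq.trans ?_ h1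
    congr 1
    have e : D.act l⁻¹ (D.act l x)⁻¹ = x⁻¹ := by
      induction x using QuotientGroup.induction_on with
      | H r =>
        rw [act_mk, ← QuotientGroup.mk_inv, act_mk]
        simp [smul_inv']
    refine Φ_congr _ ?_ _
    rw [e, mul_inv_cancel, j.map_one]
    simp [smul_mul', smul_inv', mul_assoc]

end

/-- The underlying vector space of `k[Γ/N] ⋊_Φ k^G` is `k[Γ/N] ⊗ k^G`; its multiplication and
comultiplication are defined by means of a normalized section `j`. -/
def TwistedSmashCoproduct {k Γ H : Type*} [Field k] [Group Γ] [Group H] [MulDistribMulAction H Γ]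
    (D : QuotientDatum k Γ H) (_j : D.NormalizedSection) : Type _ :=
  MonoidAlgebra k (Γ ⧸ D.N) ⊗[k] (D.G → k)

namespace TwistedSmashCoproduct

attribute [local instance] Fintype.ofFinite Classical.decEq

variable {k Γ H : Type*} [Field k] [Group Γ] [Group H] [MulDistribMulAction H Γ]
  {D : QuotientDatum k Γ H} (j : D.NormalizedSection)

instance instAddCommGroup : AddCommGroup (D.TwistedSmashCoproduct j) :=
  inferInstanceAs (AddCommGroup (MonoidAlgebra k (Γ ⧸ D.N) ⊗[k] (D.G → k)))

instance : Module k (D.TwistedSmashCoproduct j) :=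
  inferInstanceAs (Module k (MonoidAlgebra k (Γ ⧸ D.N) ⊗[k] (D.G → k)))

/-- The element `x # f = x ⊗ f`, for `x ∈ Γ/N` and `f ∈ k^G`. -/
def elt (x : Γ ⧸ D.N) (f : D.G → k) : D.TwistedSmashCoproduct j :=
  (MonoidAlgebra.single x (1 : k) ⊗ₜ[k] f : MonoidAlgebra k (Γ ⧸ D.N) ⊗[k] (D.G → k))

/-- The function `δ_h`. -/
def delta (h : D.G) : D.G → k := Pi.single h 1

theorem elt_smul (x : Γ ⧸ D.N) (c : k) (f : D.G → k) : elt j x (c • f) = c • elt j x f :=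
  TensorProduct.tmul_smul _ _ _

theorem elt_zero (x : Γ ⧸ D.N) : elt j x 0 = 0 := TensorProduct.tmul_zero _ _

theorem delta_mul (h : D.G) (f : D.G → k) : delta h * f = f h • delta h := by
  unfold delta
  ext g
  by_cases hg : g = h
  · subst hg; simp
  · simp [hg]

theorem delta_mul_delta (h g : D.G) :
    (delta h * delta g : D.G → k) = if h = g then delta h else 0 := by
  rw [delta_mul]
  by_cases hg : h = g
  · subst hg; simp [delta]
  · simp [delta, hg]

variable [Finite H]

/-- The basis `(x # δ_h)` of `k[Γ/N] ⊗ k^G`. -/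
def basis : Module.Basis ((Γ ⧸ D.N) × D.G) k (D.TwistedSmashCoproduct j) :=
  (MonoidAlgebra.basis (Γ ⧸ D.N) k).tensorProduct (Pi.basisFun k D.G)

theorem basis_apply (x : Γ ⧸ D.N) (h : D.G) : basis j (x, h) = elt j x (delta h) := by
  refine (Module.Basis.tensorProduct_apply _ _ _ _).trans ?_
  rw [MonoidAlgebra.basis_apply, Pi.basisFun_apply]
  unfold elt delta
  congr!

/-- `(x # δ_h)(y # δ_g) = xy # δ_h δ_g Φ(j(x) j(y) j(xy)⁻¹)`. -/
def mul : D.TwistedSmashCoproduct j →ₗ[k] D.TwistedSmashCoproduct j →ₗ[k]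
    D.TwistedSmashCoproduct j :=
  (basis j).constr k fun p => (basis j).constr k fun q =>
    elt j (p.1 * q.1) (delta p.2 * delta q.2 * mulCoeff j p.1 q.1)

/-- `Δ(x # δ_h) = ∑_l (x # δ_{l⁻¹}) ⊗ (l.x # δ_{lh} Φ(l.j(x) j(l.x)⁻¹))`. -/
def comul : D.TwistedSmashCoproduct j →ₗ[k]
    D.TwistedSmashCoproduct j ⊗[k] D.TwistedSmashCoproduct j :=
  (basis j).constr k fun p => ∑ l : D.G,
    elt j p.1 (delta l⁻¹) ⊗ₜ[k] elt j (D.act l p.1) (delta (l * p.2) * comulCoeff j l p.1)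

/-- `ε(x # δ_h) = δ_{h,1}`. -/
def counit : D.TwistedSmashCoproduct j →ₗ[k] k :=
  (basis j).constr k fun p => if p.2 = 1 then 1 else 0

/-- `S(x # δ_h) = h⁻¹.x⁻¹ # Φ(j(h⁻¹.x⁻¹)⁻¹ h⁻¹.j(x)⁻¹) δ_{h⁻¹}`. -/
def antipode : D.TwistedSmashCoproduct j →ₗ[k] D.TwistedSmashCoproduct j :=
  (basis j).constr k fun p =>
    elt j (D.act p.2⁻¹ p.1⁻¹) (antipodeCoeff j p.1 p.2 * delta p.2⁻¹)

theorem mul_basis (x : Γ ⧸ D.N) (h : D.G) (y : Γ ⧸ D.N) (g : D.G) :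
    mul j (basis j (x, h)) (basis j (y, g)) =
      if h = g then mulCoeff j x y h • basis j (x * y, h) else 0 := by
  simp only [mul, Module.Basis.constr_basis]
  rw [delta_mul_delta]
  split_ifs with hg
  · rw [delta_mul, elt_smul, basis_apply]
  · rw [zero_mul, elt_zero]

theorem one_eq_sum : elt j 1 1 = ∑ h, basis j (1, h) := by
  simp only [basis_apply]
  unfold elt delta
  refine Eq.trans ?_ (TensorProduct.tmul_sum _ _ _)
  rw [Finset.univ_sum_single]
  rfl

/-- The multiplication is `mul` and the unit is `1 # 1`. -/
instance : Ring (D.TwistedSmashCoproduct j) :=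
  { instAddCommGroup j with
    mul := fun a b => mul j a b
    one := elt j 1 1
    left_distrib := fun a b c => map_add (mul j a) b c
    right_distrib := fun a b c => LinearMap.map_add₂ (mul j) a b c
    zero_mul := fun a => LinearMap.map_zero₂ (mul j) a
    mul_zero := fun a => map_zero (mul j a)
    mul_assoc := by
      exact MonomialHopf.mul_assoc_of_compat _ (compat j) (mul j) (mul_basis j)
    one_mul := by
      exact MonomialHopf.one_mul_of_compat _ (compat j) (mul j) (mul_basis j) _
        (one_eq_sum j)
    mul_one := by
      exact MonomialHopf.mul_one_of_compat _ (compat j) (mul j) (mul_basis j) _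
        (one_eq_sum j) }

instance : Algebra k (D.TwistedSmashCoproduct j) :=
  Algebra.ofModule (fun c a b => LinearMap.map_smul₂ (mul j) c a b)
    (fun c a b => map_smul (mul j a) c b)

theorem comul_basis (x : Γ ⧸ D.N) (h : D.G) : comul j (basis j (x, h)) =
    ∑ l : D.G, basis j (x, l⁻¹) ⊗ₜ[k]
      (comulCoeff j l x (l * h) • basis j (D.act l x, l * h)) := by
  rw [comul, Module.Basis.constr_basis]
  simp only [basis_apply, delta_mul, elt_smul]

theorem counit_basis (x : Γ ⧸ D.N) (h : D.G) :
    counit j (basis j (x, h)) = if h = 1 then 1 else 0 := by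
  simp only [counit, Module.Basis.constr_basis]

theorem antipode_basis (x : Γ ⧸ D.N) (h : D.G) : antipode j (basis j (x, h)) =
    antipodeCoeff j x h h⁻¹ • basis j (D.act h⁻¹ x⁻¹, h⁻¹) := by
  rw [antipode, Module.Basis.constr_basis]
  simp only [mul_comm (antipodeCoeff j x h), delta_mul, elt_smul, basis_apply]

instance : Coalgebra k (D.TwistedSmashCoproduct j) where
  comul := comul j
  counit := counit j
  coassoc := MonomialHopf.coassoc_of_compat _ (compat j) _ (comul_basis j)
  rTensor_counit_comp_comul := by
    exact MonomialHopf.rTensor_of_compat _ (compat j) _ _ (comul_basis j)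
      (counit_basis j)
  lTensor_counit_comp_comul := by
    exact MonomialHopf.lTensor_of_compat _ (compat j) _ _ (comul_basis j)
      (counit_basis j)

instance : Bialgebra k (D.TwistedSmashCoproduct j) :=
  Bialgebra.mk' k _
    (by
      change counit j (elt j 1 1) = 1
      simp [one_eq_sum, counit_basis])
    (by
      exact MonomialHopf.counit_mul_of_compat _ (compat j) _ (mul_basis j)
        (counit_basis j) _ _)
    (by
      exact MonomialHopf.comul_one_of_compat _ (compat j) _ (one_eq_sum j)
        (comul_basis j))
    (by
      exact MonomialHopf.comul_mul_of_compat _ (compat j) _ (mul_basis j)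
        (comul_basis j) _ _)

instance : HopfAlgebra k (D.TwistedSmashCoproduct j) where
  antipode := antipode j
  mul_antipode_rTensor_comul := by
    exact MonomialHopf.antipode_left_of_compat _ (compat j) _ _ _ (one_eq_sum j)
      (mul_basis j) (comul_basis j) (counit_basis j) (antipode_basis j)
  mul_antipode_lTensor_comul := by
    exact MonomialHopf.antipode_right_of_compat _ (compat j) _ _ _ (one_eq_sum j)
      (mul_basis j) (comul_basis j) (counit_basis j) (antipode_basis j)

end TwistedSmashCoproduct

end QuotientDatum

end

/-! Write `e_h` for the image of `1 # δ_h` in `L`. The `e_h` are orthogonal idempotents with sum 1,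
so multiplying by `e_h` in `L`, or by `e_g ⊗ e_h` in `L ⊗ L`, isolates a single term of any
coproduct. Everything is read off from such terms.

`G` is the set of `h` with `e_h ≠ 0`; it is closed under products because `e_g ⊗ e_h` is a term of
`Δ(e_{gh})`. `N` is the set of `r` with `π(r # δ_1) = e_1`. For `r` in `N` the terms of `Δ(π(r #
δ_1)) = Δ(e_1)` give `π(r # δ_h) ⊗ π(h⁻¹.r # δ_{h⁻¹}) = e_h ⊗ e_{h⁻¹}`, and an equality of nonzero
pure tensors forces `π(r # δ_h) = Φ(r)(h) e_h` for a scalar `Φ(r)(h)`. Comparing further terms of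
coproducts shows that `N` is `G`-stable and that `Φ` is a cocycle.

The elements `π(j(x) # δ_h)` with `h` in `G` span `L`, since replacing `r` by `nr` with `n` in `N`
only costs the scalar `Φ(n)(h)` (`image_mul_left`). Their independence
(`linearIndependent_sectionImage`) is the main point: as for group-like elements, they are
simultaneous eigenvectors of operators built from `Δ` and the `e_g`, with distinct eigenvalues. In
this basis the structure constants of `L` are those of the twisted smash coproduct. -/

noncomputable section

/-! ### Linear algebra over a field: eigenvectors and pure tensors -/

/-- Simultaneous eigenvectors with pairwise distinct systems of eigenvalues are linearly
independent. -/
theorem linearIndependent_of_simultaneous_eigenvectors {k V ι κ : Type*} [Field k]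
    [AddCommGroup V] [Module k V] (T : κ → V →ₗ[k] V) (w : ι → V) (χ : ι → κ → k)
    (hT : ∀ i f, T f (w i) = χ i f • w i) (hχ : Function.Injective χ) (hw : ∀ i, w i ≠ 0) :
    LinearIndependent k w := by
  classical
  rw [linearIndependent_iff']
  intro s
  induction s using Finset.induction_on with
  | empty => simp
  | insert a s ha ih =>
    intro g hg
    have key : ∀ b ∈ s, g b = 0 := by
      intro b hb
      obtain ⟨f, hf⟩ := Function.ne_iff.mp (hχ.ne (ne_of_mem_of_not_mem hb ha))
      -- Applying `T f` to the relation and subtracting `χ a f` times the relation removes the term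
      -- `a` and leaves a relation supported on `s`.
      have h := ih (fun i => g i * (χ i f - χ a f)) ?_ b hb
      · exact (mul_eq_zero.mp h).resolve_right (sub_ne_zero.mpr hf)
      · have h1 : T f (∑ i ∈ insert a s, g i • w i) =
            χ a f • ∑ i ∈ insert a s, g i • w i := by rw [hg, map_zero, smul_zero]
        rw [← sub_eq_zero, map_sum, Finset.smul_sum, ← Finset.sum_sub_distrib,
          Finset.sum_insert ha, map_smul, hT, smul_comm, sub_self, zero_add] at h1
        rw [← h1]
        refine Finset.sum_congr rfl fun i _ => ?_
        rw [map_smul, hT, smul_comm (χ a f), ← smul_sub, ← sub_smul, smul_smul]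
    intro i hi
    rcases Finset.mem_insert.mp hi with rfl | hi
    · rw [Finset.sum_insert ha, Finset.sum_eq_zero fun i hi => by rw [key i hi, zero_smul],
        add_zero] at hg
      exact (smul_eq_zero.mp hg).resolve_right (hw i)
    · exact key i hi

theorem tmul_ne_zero_of_ne_zero {k V W : Type*} [Field k] [AddCommGroup V] [Module k V]
    [AddCommGroup W] [Module k W] {v : V} {w : W} (hv : v ≠ 0) (hw : w ≠ 0) :
    v ⊗ₜ[k] w ≠ 0 := by
  intro h
  obtain ⟨f, hf⟩ := Module.Projective.exists_dual_ne_zero k hv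
  have := congrArg (fun t => TensorProduct.lid k W (f.rTensor W t)) h
  simp [hf, hw] at this

/-- A factor of a pure tensor that equals a nonzero pure tensor is proportional to the
corresponding factor. -/
theorem exists_eq_smul_of_tmul_eq_tmul {k V W : Type*} [Field k] [AddCommGroup V] [Module k V]
    [AddCommGroup W] [Module k W] {v v' : V} {w w' : W} (hw : w ≠ 0)
    (h : v' ⊗ₜ[k] w' = v ⊗ₜ[k] w) (hv : v ≠ 0) : ∃ c : k, v' = c • v := by
  obtain ⟨f, hf⟩ := Module.Projective.exists_dual_ne_zero k hw
  -- Contract the second factor with a functional that does not vanish on `w`.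
  have h' : f w' • v' = f w • v := by
    simpa using congrArg (fun t => TensorProduct.rid k V (f.lTensor V t)) h
  have hne : f w' ≠ 0 := by
    intro h0
    rw [h0, zero_smul] at h'
    exact smul_ne_zero hf hv h'.symm
  exact ⟨(f w')⁻¹ * f w, by rw [mul_smul, ← h', inv_smul_smul₀ hne]⟩

namespace SmashCoproduct

section Quotient

attribute [local instance] Fintype.ofFinite Classical.decEq

variable {k Γ H L : Type*} [Field k] [Group Γ] [Group H] [Finite H]
    [MulDistribMulAction H Γ] [Ring L] [HopfAlgebra k L]
    (π : SmashCoproduct k Γ H →ₐc[k] L)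

/-! ### Relations between the images of the basis vectors -/

/-- The image of `r # δ_h` in a quotient. -/
def image (r : Γ) (h : H) : L := π (basis k Γ H (r, h))

theorem image_mul (x y : Γ) (h g : H) :
    image π x h * image π y g = if h = g then image π (x * y) h else 0 := by
  unfold image
  rw [← map_mul, basis_mul]
  split_ifs <;> simp

theorem image_mul_same (x y : Γ) (h : H) : image π x h * image π y h = image π (x * y) h := by
  rw [image_mul, if_pos rfl]

theorem one_eq_sum_image : (1 : L) = ∑ h : H, image π 1 h := by
  rw [← map_one π, one_eq_sum, map_sum]
  rfl

theorem comul_image (x : Γ) (h : H) : Coalgebra.comul (R := k) (image π x h) =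
    ∑ l : H, image π x l⁻¹ ⊗ₜ[k] image π (l • x) (l * h) := by
  unfold image
  rw [← CoalgHomClass.map_comp_comul_apply]
  change TensorProduct.map _ _ (comul k Γ H (basis k Γ H (x, h))) = _
  rw [comul_basis]
  simp

theorem counit_image (x : Γ) (h : H) :
    Coalgebra.counit (R := k) (image π x h) = if h = 1 then 1 else 0 := by
  unfold image
  rw [CoalgHomClass.counit_comp_apply]
  exact counit_basis x h

/-- Orthogonality of the idempotents leaves only the term of index `l`. This is how identities in `L
⊗ L` are compared term by term. -/
theorem comul_image_mul (x : Γ) (l h : H) :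
    Coalgebra.comul (R := k) (image π x h) * (image π 1 l⁻¹ ⊗ₜ[k] image π 1 (l * h)) =
      image π x l⁻¹ ⊗ₜ[k] image π (l • x) (l * h) := by
  rw [comul_image, Finset.sum_mul, Finset.sum_eq_single l]
  · simp [image_mul]
  · intro m _ hm
    simp [image_mul, hm]
  · simp

/-- A substitute for group-likeness: after this truncation the left factor no longer depends on `h`.
It supplies the operators used for linear independence. -/
theorem comul_image_mul_one (x : Γ) (h : H) :
    Coalgebra.comul (R := k) (image π x h) * (image π 1 1 ⊗ₜ[k] 1) =
      image π x 1 ⊗ₜ[k] image π x h := by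
  rw [comul_image, Finset.sum_mul, Finset.sum_eq_single 1]
  · simp [image_mul]
  · intro m _ hm
    simp [image_mul, hm]
  · simp

theorem image_one_one_ne_zero : image π 1 1 ≠ 0 := by
  intro h
  have := counit_image π 1 1
  simp [h] at this

/-- The term of index `g⁻¹` in the coproduct of `image π 1 (g * h)` is a tensor product of two
nonzero vectors. -/
theorem image_one_mul_ne_zero {g h : H} (hg : image π 1 g ≠ 0) (hh : image π 1 h ≠ 0) :
    image π 1 (g * h) ≠ 0 := by
  intro h0
  have := comul_image_mul π 1 g⁻¹ (g * h)
  rw [h0, map_zero, zero_mul, inv_inv, smul_one, inv_mul_cancel_left] at this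
  exact tmul_ne_zero_of_ne_zero hg hh this.symm

theorem image_ne_zero {h : H} (hh : image π 1 h ≠ 0) (r : Γ) : image π r h ≠ 0 := by
  intro h0
  refine hh ?_
  rw [← mul_inv_cancel r, ← image_mul_same, h0, zero_mul]

theorem image_eq_zero {h : H} (hh : image π 1 h = 0) (r : Γ) : image π r h = 0 := by
  rw [← mul_one r, ← image_mul_same, hh, mul_zero]

/-! ### The quotient datum attached to a quotient -/

/-- The subgroup of the `h` such that `δ_h` is not killed by `π`. -/
def support : Subgroup H where
  carrier := {h | image π 1 h ≠ 0}
  one_mem' := image_one_one_ne_zero π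
  mul_mem' := image_one_mul_ne_zero π
  inv_mem' {h} hh := by
    have key : ∀ n : ℕ, image π 1 (h ^ n) ≠ 0 := by
      intro n
      induction n with
      | zero => simpa using image_one_one_ne_zero π
      | succ n ih => rw [pow_succ]; exact image_one_mul_ne_zero π ih hh
    change image π 1 h⁻¹ ≠ 0
    -- As `H` is finite, the inverse of `h` is a power of `h` with natural exponent, so closure
    -- under products suffices.
    obtain ⟨n, hn⟩ := mem_powers_iff_mem_zpowers.mpr (inv_mem (Subgroup.mem_zpowers h))
    rw [← hn]
    exact key n

theorem image_one_ne_zero (h : support π) : image π 1 (h : H) ≠ 0 := h.2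

/-- The subgroup of the `r` such that `π(r # δ_1) = π(1 # δ_1)`. -/
def kernel : Subgroup Γ where
  carrier := {r | image π r 1 = image π 1 1}
  one_mem' := rfl
  mul_mem' {r s} hr hs := by
    change image π r 1 = _ at hr
    change image π s 1 = _ at hs
    change image π (r * s) 1 = _
    rw [← image_mul_same, hr, hs, image_mul_same, mul_one]
  inv_mem' {r} hr := by
    change image π r 1 = _ at hr
    change image π r⁻¹ 1 = _
    rw [← one_mul r⁻¹, ← image_mul_same, ← hr, image_mul_same, mul_inv_cancel, hr]

theorem mem_kernel {r : Γ} : r ∈ kernel π ↔ image π r 1 = image π 1 1 := Iff.rfl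

theorem kernel_normal : (kernel π).Normal where
  conj_mem r hr s := by
    rw [mem_kernel] at hr ⊢
    rw [← image_mul_same, ← image_mul_same, hr, image_mul_same, image_mul_same, mul_one,
      mul_inv_cancel]

/-- The elements `r # δ_1` and `1 # δ_1` have the same image, hence the same coproduct; its terms of
index `h⁻¹` are two equal nonzero pure tensors. -/
theorem exists_coeff {r : Γ} (hr : r ∈ kernel π) (h : support π) :
    ∃ c : k, image π r (h : H) = c • image π 1 (h : H) := by
  have h1 := comul_image_mul π r (h : H)⁻¹ 1
  rw [(mem_kernel π).mp hr, comul_image_mul, inv_inv, mul_one, smul_one] at h1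
  exact exists_eq_smul_of_tmul_eq_tmul (image_one_ne_zero π h⁻¹) h1.symm (image_one_ne_zero π h)

/-- The scalar by which `r` acts on the component of `h`, for `r` in the kernel. -/
def coeff (r : kernel π) (h : support π) : k := (exists_coeff π r.2 h).choose

theorem image_eq_coeff (r : kernel π) (h : support π) :
    image π (r : Γ) (h : H) = coeff π r h • image π 1 (h : H) := (exists_coeff π r.2 h).choose_spec

theorem coeff_unique (r : kernel π) (h : support π) {c : k}
    (hc : image π (r : Γ) (h : H) = c • image π 1 (h : H)) : coeff π r h = c :=
  smul_left_injective k (image_one_ne_zero π h) ((image_eq_coeff π r h).symm.trans hc)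

theorem coeff_ne_zero (r : kernel π) (h : support π) : coeff π r h ≠ 0 := by
  intro h0
  have := image_eq_coeff π r h
  rw [h0, zero_smul] at this
  exact image_ne_zero π (image_one_ne_zero π h) _ this

/-- The term of index `l` in the coproduct of `image π r h`, computed directly and through
`image_eq_coeff`. Both the stability of `N` and the cocycle identity come from it. -/
theorem coeff_smul_tmul (r : kernel π) (l h : support π) :
    coeff π r l⁻¹ • (image π 1 (l : H)⁻¹ ⊗ₜ[k] image π ((l : H) • (r : Γ)) (l * h : H)) =
      coeff π r h • (image π 1 (l : H)⁻¹ ⊗ₜ[k] image π 1 (l * h : H)) := by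
  have h1 := comul_image_mul π (r : Γ) (l : H) (h : H)
  have h2 := image_eq_coeff π r l⁻¹
  rw [Subgroup.coe_inv] at h2
  rw [image_eq_coeff, map_smul, smul_mul_assoc, comul_image_mul, smul_one, h2] at h1
  rw [h1, TensorProduct.smul_tmul']

theorem coeff_smul_image (r : kernel π) (l h : support π) :
    coeff π r l⁻¹ • image π ((l : H) • (r : Γ)) (l * h : H) =
      coeff π r h • image π 1 (l * h : H) := by
  obtain ⟨f, hf⟩ := Module.Projective.exists_dual_ne_zero k (image_one_ne_zero π l⁻¹)
  have := congrArg (fun t => TensorProduct.lid k L (f.rTensor L t)) (coeff_smul_tmul π r l h)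
  simp only [map_smul, LinearMap.rTensor_tmul, TensorProduct.lid_tmul] at this
  rw [smul_comm, smul_comm _ (f _)] at this
  exact smul_right_injective L hf this

theorem smul_mem_kernel (l : support π) {r : Γ} (hr : r ∈ kernel π) : l • r ∈ kernel π := by
  -- With `h = l⁻¹` the scalars on the two sides coincide and cancel.
  have := coeff_smul_image π ⟨r, hr⟩ l l⁻¹
  rw [Subgroup.coe_inv, mul_inv_cancel] at this
  exact smul_right_injective L (coeff_ne_zero π ⟨r, hr⟩ l⁻¹) this

/-- The morphism `r ↦ coeff r` into the units of `k^G`. -/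
def coeffHom : kernel π →* (support π → k)ˣ :=
  MonoidHom.toHomUnits
    { toFun := coeff π
      map_one' := by
        ext h
        exact coeff_unique π _ _ (one_smul _ _).symm
      map_mul' := by
        intro r s
        ext h
        refine coeff_unique π _ _ ?_
        rw [Subgroup.coe_mul, ← image_mul_same, image_eq_coeff, image_eq_coeff,
          smul_mul_smul_comm, image_mul_same, mul_one]
        rfl }

theorem coeffHom_apply (r : kernel π) (h : support π) :
    (coeffHom π r : support π → k) h = coeff π r h := rfl

/-- The quotient datum of a quotient of the smash coproduct. -/
def quotientDatum : QuotientDatum k Γ H where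
  G := support π
  N := kernel π
  normal := kernel_normal π
  stable := smul_mem_kernel π
  Φ := coeffHom π
  Φ_mul r l h := by
    simp only [coeffHom_apply]
    -- These arguments make the second index `l⁻¹ * (l * h) = h`, where `image_eq_coeff` applies to
    -- `l⁻¹ • r`.
    have h1 := coeff_smul_image π r l⁻¹ (l * h)
    have h2 := image_eq_coeff π ⟨l⁻¹ • (r : Γ), smul_mem_kernel π l⁻¹ r.2⟩ h
    simp only [inv_inv, Subgroup.coe_inv, Subgroup.coe_mul, inv_mul_cancel_left] at h1
    change image π ((l : H)⁻¹ • (r : Γ)) (h : H) = _ at h2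
    rw [h2, smul_smul] at h1
    rw [mul_comm]
    exact (smul_left_injective k (image_one_ne_zero π h) h1).symm
  Φ_conj r s := by
    ext h
    simp only [coeffHom_apply]
    refine (coeff_unique π _ _ ?_).symm
    change image π (s * r * s⁻¹) (h : H) = _
    rw [← image_mul_same, ← image_mul_same, image_eq_coeff, mul_smul_comm, smul_mul_assoc,
      image_mul_same, image_mul_same, mul_one, mul_inv_cancel]

/-- The effect of changing the representative of a coset; all coefficients of the twisted structure
arise from it. -/
theorem image_mul_left {n : Γ} (hn : n ∈ kernel π) (r : Γ) (h : support π) :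
    image π (n * r) (h : H) =
      ((quotientDatum π).Φ ⟨n, hn⟩ : (quotientDatum π).G → k) h • image π r (h : H) := by
  change _ = coeff π ⟨n, hn⟩ h • _
  rw [← image_mul_same, image_eq_coeff π ⟨n, hn⟩ h, smul_mul_assoc, image_mul_same, one_mul]

/-! ### A basis of the quotient -/

variable (j : (quotientDatum π).NormalizedSection)

theorem image_section_injective :
    Function.Injective fun x : Γ ⧸ (quotientDatum π).N => image π (j x) 1 := by
  intro x y hxy
  rw [← j.mk_toFun x, ← j.mk_toFun y, QuotientGroup.eq]
  change image π ((j x)⁻¹ * j y) 1 = _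
  rw [← image_mul_same, ← show image π (j x) 1 = image π (j y) 1 from hxy, image_mul_same,
    inv_mul_cancel]

/-- The family `π(j(x) # δ_h)`, for `x ∈ Γ/N` and `h ∈ G`. -/
def sectionImage (p : (Γ ⧸ (quotientDatum π).N) × (quotientDatum π).G) : L :=
  image π (j p.1) (p.2 : H)

/-- The operators `T₁ f : y ↦ (f ⊗ id)(Δ(y)(e_1 ⊗ 1))` have eigenvalues `f (image π (j x) 1)`, which
determine `x`; right multiplication by `e_g` has eigenvalue 1 or 0 and detects `h`. -/
theorem linearIndependent_sectionImage : LinearIndependent k (sectionImage π j) := by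
  let T₁ (f : Module.Dual k L) : L →ₗ[k] L :=
    (TensorProduct.lid k L).toLinearMap ∘ₗ f.rTensor L ∘ₗ
      LinearMap.mulRight k (image π 1 1 ⊗ₜ[k] (1 : L)) ∘ₗ Coalgebra.comul
  let T₂ (g : H) : L →ₗ[k] L := LinearMap.mulRight k (image π 1 g)
  refine linearIndependent_of_simultaneous_eigenvectors (κ := Module.Dual k L ⊕ H)
    (Sum.elim T₁ T₂) _
    (fun p => Sum.elim (fun f => f (image π (j p.1) 1))
      (fun g => if (p.2 : H) = g then 1 else 0)) ?_ ?_ ?_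
  · rintro ⟨x, h⟩ (f | g)
    · simp [T₁, sectionImage, comul_image_mul_one]
    · simp [T₂, sectionImage, image_mul]
  · rintro ⟨x, h⟩ ⟨y, g⟩ hp
    refine Prod.ext (image_section_injective π j ?_) ?_
    -- Functionals separate the points of `L`, so the eigenvalues of all `T₁ f` recover `image π (j
    -- x) 1`.
    · refine sub_eq_zero.mp ((Module.forall_dual_apply_eq_zero_iff k _).mp fun f => ?_)
      rw [map_sub, sub_eq_zero]
      exact congrFun hp (Sum.inl f)
    · have := congrFun hp (Sum.inr (g : H))
      simp only [Sum.elim_inr, if_true] at this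
      by_contra hne
      rw [if_neg fun h' => hne (Subtype.ext h')] at this
      exact zero_ne_one this
  · rintro ⟨x, h⟩
    exact image_ne_zero π (image_one_ne_zero π h) _

theorem image_eq_smul_sectionImage (r : Γ) (h : support π) :
    ∃ c : k, image π r (h : H) = c • sectionImage π j ((r : Γ ⧸ (quotientDatum π).N), h) := by
  have hn : r * (j (r : Γ ⧸ (quotientDatum π).N))⁻¹ ∈ (quotientDatum π).N := by
    rw [← QuotientGroup.eq_one_iff]
    simp [j.mk_toFun]
  have := image_mul_left π hn (j (r : Γ ⧸ (quotientDatum π).N)) h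
  rw [inv_mul_cancel_right] at this
  exact ⟨_, this⟩

theorem span_sectionImage (hπ : Function.Surjective π) :
    ⊤ ≤ Submodule.span k (Set.range (sectionImage π j)) := by
  rintro a -
  obtain ⟨b, rfl⟩ := hπ a
  induction b using MonomialHopf.basis_induction (basis k Γ H) with
  | h0 => simp
  | ha x y hx hy => rw [map_add]; exact add_mem hx hy
  | hs c x hx => rw [map_smul]; exact Submodule.smul_mem _ _ hx
  | hb i =>
    obtain ⟨r, h⟩ := i
    change image π r h ∈ _
    by_cases hh : image π 1 h = 0
    · rw [image_eq_zero π hh]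
      exact zero_mem _
    · obtain ⟨c, hc⟩ := image_eq_smul_sectionImage π j r ⟨h, hh⟩
      rw [show image π r h = _ from hc]
      exact Submodule.smul_mem _ _ (Submodule.subset_span ⟨_, rfl⟩)

/-- The basis `π(j(x) # δ_h)` of the quotient. -/
def quotientBasis (hπ : Function.Surjective π) :
    Module.Basis ((Γ ⧸ (quotientDatum π).N) × (quotientDatum π).G) k L :=
  Module.Basis.mk (linearIndependent_sectionImage π j) (span_sectionImage π j hπ)

/-! ### Comparison with the twisted smash coproduct -/

variable (hπ : Function.Surjective π)

/-- The linear equivalence `x # δ_h ↦ π(j(x) # δ_h)`. -/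
def twistedLinearEquiv : (quotientDatum π).TwistedSmashCoproduct j ≃ₗ[k] L :=
  (QuotientDatum.TwistedSmashCoproduct.basis j).equiv (quotientBasis π j hπ) (Equiv.refl _)

open QuotientDatum in
theorem twistedLinearEquiv_basis (x : Γ ⧸ (quotientDatum π).N) (h : (quotientDatum π).G) :
    twistedLinearEquiv π j hπ (TwistedSmashCoproduct.basis j (x, h)) =
      image π (j x) (h : H) := by
  rw [twistedLinearEquiv, Module.Basis.equiv_apply, quotientBasis, Module.Basis.mk_apply]
  rfl

theorem twistedLinearEquiv_one : twistedLinearEquiv π j hπ 1 = 1 := by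
  have h1 : (1 : (quotientDatum π).TwistedSmashCoproduct j) = _ :=
    QuotientDatum.TwistedSmashCoproduct.one_eq_sum j
  rw [h1, map_sum, one_eq_sum_image π]
  refine Fintype.sum_of_injective (fun h : (quotientDatum π).G => (h : H))
    Subtype.val_injective _ _ (fun h hh => ?_) fun h => ?_
  · by_contra h0
    exact hh ⟨⟨h, h0⟩, rfl⟩
  · rw [twistedLinearEquiv_basis, j.map_one]

theorem twistedLinearEquiv_mul (u v : (quotientDatum π).TwistedSmashCoproduct j) :
    twistedLinearEquiv π j hπ (u * v) =
      twistedLinearEquiv π j hπ u * twistedLinearEquiv π j hπ v := by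
  let b := QuotientDatum.TwistedSmashCoproduct.basis j
  induction u using MonomialHopf.basis_induction b with
  | h0 => simp
  | ha x y hx hy => simp [hx, hy, add_mul]
  | hs c x hx => simp [hx]
  | hb p =>
  induction v using MonomialHopf.basis_induction b with
  | h0 => simp
  | ha x y hx hy => simp [hx, hy, mul_add]
  | hs c x hx => simp [hx]
  | hb q =>
  obtain ⟨x, h⟩ := p
  obtain ⟨y, g⟩ := q
  have hmul : b (x, h) * b (y, g) = _ := QuotientDatum.TwistedSmashCoproduct.mul_basis j x h y g
  rw [hmul]
  simp only [b, twistedLinearEquiv_basis]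
  rw [image_mul]
  by_cases hg : h = g
  · subst hg
    rw [if_pos rfl, if_pos rfl, map_smul, twistedLinearEquiv_basis]
    -- Here `j x * j y = n * j (x * y)` with `n` in `N`, and `n` contributes exactly `mulCoeff`.
    have := image_mul_left π (QuotientDatum.mem_mul j x y) (j (x * y)) h
    rw [inv_mul_cancel_right] at this
    exact this.symm
  · rw [if_neg hg, if_neg fun h' => hg (Subtype.ext h'), map_zero]

theorem twistedLinearEquiv_counit (u : (quotientDatum π).TwistedSmashCoproduct j) :
    Coalgebra.counit (R := k) (twistedLinearEquiv π j hπ u) = Coalgebra.counit u := by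
  suffices Coalgebra.counit ∘ₗ (twistedLinearEquiv π j hπ).toLinearMap = Coalgebra.counit from
    LinearMap.congr_fun this u
  refine (QuotientDatum.TwistedSmashCoproduct.basis j).ext fun ⟨x, h⟩ => ?_
  refine Eq.trans ?_ (QuotientDatum.TwistedSmashCoproduct.counit_basis j x h).symm
  rw [LinearMap.comp_apply, LinearEquiv.coe_coe, twistedLinearEquiv_basis, counit_image]
  simp only [OneMemClass.coe_eq_one]

theorem twistedLinearEquiv_comul (u : (quotientDatum π).TwistedSmashCoproduct j) :
    TensorProduct.map (twistedLinearEquiv π j hπ).toLinearMap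
        (twistedLinearEquiv π j hπ).toLinearMap (Coalgebra.comul u) =
      Coalgebra.comul (R := k) (twistedLinearEquiv π j hπ u) := by
  suffices TensorProduct.map (twistedLinearEquiv π j hπ).toLinearMap
      (twistedLinearEquiv π j hπ).toLinearMap ∘ₗ Coalgebra.comul =
      Coalgebra.comul ∘ₗ (twistedLinearEquiv π j hπ).toLinearMap from LinearMap.congr_fun this u
  refine (QuotientDatum.TwistedSmashCoproduct.basis j).ext fun ⟨x, h⟩ => ?_
  have hc : Coalgebra.comul (R := k) (QuotientDatum.TwistedSmashCoproduct.basis j (x, h)) = _ :=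
    QuotientDatum.TwistedSmashCoproduct.comul_basis j x h
  rw [LinearMap.comp_apply, LinearMap.comp_apply, LinearEquiv.coe_coe, twistedLinearEquiv_basis,
    comul_image, hc, map_sum]
  refine Fintype.sum_of_injective (fun l : (quotientDatum π).G => (l : H))
    Subtype.val_injective _ _ (fun l hl => ?_) fun l => ?_
  -- The coproduct in `L` is a sum over `H`; for `l` outside `G` the inverse is also outside, so the
  -- left factor vanishes.
  · have h0 : image π 1 l⁻¹ = 0 := by
      by_contra h0
      exact hl ⟨⟨l, (inv_mem_iff (H := support π)).mp h0⟩, rfl⟩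
    rw [image_eq_zero π h0, TensorProduct.zero_tmul]
  · rw [TensorProduct.map_tmul, LinearEquiv.coe_coe, map_smul, twistedLinearEquiv_basis,
      twistedLinearEquiv_basis, Subgroup.coe_inv]
    congr 1
    -- Likewise `l • j x = n * j (l.x)`, and `n` contributes `comulCoeff`.
    have := image_mul_left π (QuotientDatum.mem_comul j l x) (j ((quotientDatum π).act l x)) (l * h)
    rw [inv_mul_cancel_right] at this
    exact this.symm

/-- The isomorphism `k[Γ/N] ⋊_Φ k^G ≃ L` attached to a quotient `L` of `k[Γ] ⋊ k^H`. -/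
def twistedBialgEquiv : (quotientDatum π).TwistedSmashCoproduct j ≃ₐc[k] L :=
  BialgEquiv.ofAlgEquiv
    (AlgEquiv.ofLinearEquiv (twistedLinearEquiv π j hπ) (twistedLinearEquiv_one π j hπ)
      (twistedLinearEquiv_mul π j hπ))
    (AlgHom.ext (twistedLinearEquiv_counit π j hπ))
    (AlgHom.ext (twistedLinearEquiv_comul π j hπ))

end Quotient

end SmashCoproduct

end

/-- The datum depends only on `π`, and `j` merely selects the basis, so one datum serves all
sections. A bialgebra isomorphism between Hopf algebras automatically commutes with the antipodes.
-/
theorem theorem2p7 {k Γ H L : Type*} [Field k] [Group Γ] [Group H] [Finite H]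
    [MulDistribMulAction H Γ] [Ring L] [HopfAlgebra k L]
    (π : SmashCoproduct k Γ H →ₐc[k] L) (hπ : Function.Surjective π) :
    ∃ D : QuotientDatum k Γ H, ∀ j : D.NormalizedSection,
      Nonempty (L ≃ₐc[k] D.TwistedSmashCoproduct j) :=
  ⟨SmashCoproduct.quotientDatum π, fun j => ⟨(SmashCoproduct.twistedBialgEquiv π j hπ).symm⟩⟩
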